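/- Let $H(\mathbb{C})$ be the algebra of entire functions with the compact-open topology, and let $D$ be complex differentiation on $H(\mathbb{C})$. An entire function $\Phi(z)=\sum_{n\ge 0}a_nz^n$ is of exponential type if there are constants $A,B$ with $|\Phi(z)|\le A e^{B|z|}$ for all $z\in\mathbb{C}$; in that case $\Phi(D)f:=\sum_{n\ge 0}a_nD^nf$ defines a continuous linear operator on $H(\mathbb{C})$. A vector $f\in H(\mathbb{C})$ is hypercyclic for an operator $T$ if its orbit $\{T^nf:n\ge 0\}$ is dense in $H(\mathbb{C})$. The operator $T$ supports a hypercyclic algebra if there is a nonzero (not necessarily unital) subalgebra of $H(\mathbb{C})$ all of whose nonzero elements are hypercyclic for $T$. Write $\mathbb{D}=\{z\in\mathbb{C}:|z|<1\}$. **Theorem.** Let $\Phi$ be entire of exponential type with $|\Phi(0)|=1$ and $\Phi''(0)\Phi(0)\ne\Phi'(0)^2$. Suppose that $\Phi^{-1}(\mathbb{D})$ contains arbitrarily long arithmetic progressions of the form $\{ja\}_{j=1}^m$ with $a\neq 0$; that is, for every $m\in\mathbb{N}$ there is $a\in\mathbb{C}\setminus\{0\}$, which may depend on $m$, such that $|\Phi(ja)|<1$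 for $j=1,\dots,m$. Then $\Phi(D)$ supports a hypercyclic algebra. -/

import Mathlib

/-- The algebra of entire functions, as a subalgebra of the algebra `C(ℂ, ℂ)` of continuous
functions. -/
def entireSubalgebra : Subalgebra ℂ C(ℂ, ℂ) where
  carrier := {f | Differentiable ℂ f}
  mul_mem' hf hg := Differentiable.mul hf hg
  add_mem' hf hg := Differentiable.add hf hg
  algebraMap_mem' c := differentiable_const c

/-- The space `H(ℂ)` of entire functions. Its algebra structure (pointwise operations) and its
topology are those induced by `C(ℂ, ℂ)`; the latter is the compact-open topology, that is, the
topology of uniform convergence on compact sets. -/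
def EntireFun : Type := entireSubalgebra

namespace EntireFun

noncomputable instance : CommRing EntireFun := inferInstanceAs (CommRing entireSubalgebra)

noncomputable instance : Algebra ℂ EntireFun := inferInstanceAs (Algebra ℂ entireSubalgebra)

instance : TopologicalSpace EntireFun := inferInstanceAs (TopologicalSpace entireSubalgebra)

instance : T2Space EntireFun := inferInstanceAs (T2Space entireSubalgebra)

/-- The inclusion of `H(ℂ)` into `C(ℂ, ℂ)`. -/
noncomputable def val : EntireFun →ₐ[ℂ] C(ℂ, ℂ) := entireSubalgebra.val

theorem isInducing_val : Topology.IsInducing val := Topology.IsInducing.subtypeVal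

theorem val_injective : Function.Injective val := Subtype.val_injective

instance : IsTopologicalRing EntireFun where
  continuous_add := isInducing_val.continuous_iff.2
    ((isInducing_val.continuous.comp continuous_fst).add
      (isInducing_val.continuous.comp continuous_snd))
  continuous_mul := isInducing_val.continuous_iff.2
    ((isInducing_val.continuous.comp continuous_fst).mul
      (isInducing_val.continuous.comp continuous_snd))
  continuous_neg := isInducing_val.continuous_iff.2 isInducing_val.continuous.neg

instance : ContinuousSMul ℂ EntireFun where
  continuous_smul := isInducing_val.continuous_iff.2
    (continuous_fst.smul (isInducing_val.continuous.comp continuous_snd))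

noncomputable instance : FunLike EntireFun ℂ ℂ where
  coe f := val f
  coe_injective _ _ h := val_injective (DFunLike.coe_injective h)

@[ext]
theorem ext {f g : EntireFun} (h : ∀ z, f z = g z) : f = g := DFunLike.ext f g h

theorem differentiable (f : EntireFun) : Differentiable ℂ f := Subtype.property f

/-- An entire function as an element of `H(ℂ)`. -/
def mk (f : ℂ → ℂ) (hf : Differentiable ℂ f) : EntireFun := ⟨⟨f, hf.continuous⟩, hf⟩

/-- The operator `D` of complex differentiation on `H(ℂ)`. -/
noncomputable def D : EntireFun →ₗ[ℂ] EntireFun where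
  toFun f := mk (deriv f) f.differentiable.deriv
  map_add' f g := by
    ext z
    exact deriv_add (f.differentiable z) (g.differentiable z)
  map_smul' c f := by
    ext z
    exact deriv_const_smul c (f.differentiable z)

theorem iterate_D_apply (n : ℕ) (f : EntireFun) (z : ℂ) :
    ((D ^ n) f) z = iteratedDeriv n f z := by
  have h : ∀ n : ℕ, ⇑((D ^ n) f) = iteratedDeriv n f := by
    intro n
    induction n with
    | zero => rfl
    | succ k ih =>
      rw [iteratedDeriv_succ, ← ih, pow_succ']
      rfl
  rw [h n]

theorem isClosed : IsClosed (entireSubalgebra : Set C(ℂ, ℂ)) := by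
  refine isClosed_of_closure_subset fun f hf => ?_
  obtain ⟨u, hu, hlim⟩ := mem_closure_iff_ultrafilter.1 hf
  rw [← Filter.tendsto_id', ContinuousMap.tendsto_iff_tendstoLocallyUniformly,
    ← tendstoLocallyUniformlyOn_univ] at hlim
  have h := hlim.differentiableOn (by
    filter_upwards [hu] with g hg
    exact Differentiable.differentiableOn hg) isOpen_univ
  exact differentiableOn_univ.1 h

end EntireFun

/-- An entire function of exponential type: `Φ` is holomorphic on `ℂ`, and there are constants `A`
and `B` with `|Φ(z)| ≤ A e^{B|z|}` for all `z`. -/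
def IsEntireOfExponentialType (Φ : ℂ → ℂ) : Prop :=
  Differentiable ℂ Φ ∧ ∃ A B : ℝ, ∀ z : ℂ, ‖Φ z‖ ≤ A * Real.exp (B * ‖z‖)

/-- The `n`-th Taylor coefficient at the origin. -/
noncomputable def taylorCoeff (Φ : ℂ → ℂ) (n : ℕ) : ℂ :=
  iteratedDeriv n Φ 0 / (n.factorial : ℂ)

theorem IsEntireOfExponentialType.exists_coeff_bound {Φ : ℂ → ℂ}
    (hΦ : IsEntireOfExponentialType Φ) :
    ∃ A R : ℝ, 0 ≤ A ∧ 0 < R ∧ ∀ n : ℕ, ‖taylorCoeff Φ n‖ ≤ A * R ^ n / n.factorial := by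
  obtain ⟨hd, A, B, hAB⟩ := hΦ
  have hA : 0 ≤ A := by
    have := (norm_nonneg _).trans (hAB 0)
    simpa using this
  refine ⟨A, Real.exp B, hA, Real.exp_pos _, fun n => ?_⟩
  have hfac : (0 : ℝ) < n.factorial := by exact_mod_cast n.factorial_pos
  rw [taylorCoeff, norm_div, Complex.norm_natCast]
  gcongr
  rcases Nat.eq_zero_or_pos n with rfl | hn
  · simpa using hAB 0
  have hn' : (0 : ℝ) < n := by exact_mod_cast hn
  have key := Complex.norm_iteratedDeriv_le_of_forall_mem_sphere_norm_le (c := (0 : ℂ)) (f := Φ) n hn'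
    hd.diffContOnCl (C := A * Real.exp (B * n)) (fun z hz => by
      have hz' : ‖z‖ = n := by simpa using hz
      simpa [hz'] using hAB z)
  refine key.trans ?_
  have h1 : (n.factorial : ℝ) ≤ (n : ℝ) ^ n := by exact_mod_cast n.factorial_le_pow
  rw [div_le_iff₀ (by positivity), ← Real.exp_nat_mul, mul_comm (n : ℝ) B, mul_comm]
  gcongr

namespace EntireFun

theorem norm_term_le {Φ : ℂ → ℂ} {A R : ℝ} (hA : 0 ≤ A) (hR : 0 < R)
    (h : ∀ n : ℕ, ‖taylorCoeff Φ n‖ ≤ A * R ^ n / n.factorial) (f : EntireFun) {r M : ℝ}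
    (hM : ∀ z : ℂ, ‖z‖ ≤ r + 2 * R → ‖f z‖ ≤ M) (n : ℕ) {z : ℂ} (hz : ‖z‖ ≤ r) :
    ‖(taylorCoeff Φ n • (D ^ n) f) z‖ ≤ A * M * (1 / 2) ^ n := by
  have key := Complex.norm_iteratedDeriv_le_of_forall_mem_sphere_norm_le (c := z)
    (f := f) n (R := 2 * R) (by positivity) f.differentiable.diffContOnCl (C := M)
    (fun w hw => hM w (by
      have h1 : ‖w - z‖ = 2 * R := by simpa using hw
      have h2 := norm_le_norm_add_norm_sub' w z
      linarith))
  have hfac : (0 : ℝ) < n.factorial := by exact_mod_cast n.factorial_pos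
  have e : (taylorCoeff Φ n • (D ^ n) f) z
      = taylorCoeff Φ n * iteratedDeriv n f z := by
    rw [← iterate_D_apply]; rfl
  rw [e, norm_mul]
  refine (mul_le_mul (h n) key (norm_nonneg _) (by positivity)).trans (le_of_eq ?_)
  rw [mul_pow, one_div, inv_pow]
  field_simp

theorem exists_bound (f : EntireFun) (r : ℝ) :
    ∃ M : ℝ, ∀ z : ℂ, ‖z‖ ≤ r → ‖f z‖ ≤ M := by
  obtain ⟨M, hM⟩ := (isCompact_closedBall (0 : ℂ) r).exists_bound_of_continuousOn
    (val f).continuous.continuousOn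
  exact ⟨M, fun z hz => hM z (by simpa using hz)⟩

/-- For `Φ(z) = ∑ aₙ zⁿ` of exponential type, the series `∑ aₙ Dⁿ f` converges in `H(ℂ)`. -/
theorem summable_taylorCoeff_smul {Φ : ℂ → ℂ} (hΦ : IsEntireOfExponentialType Φ) (f : EntireFun) :
    Summable fun n : ℕ => taylorCoeff Φ n • (D ^ n) f := by
  obtain ⟨A, R, hA, hR, h⟩ := hΦ.exists_coeff_bound
  have hs : Summable fun n : ℕ => val (taylorCoeff Φ n • (D ^ n) f) := by
    refine ContinuousMap.summable_of_locally_summable_norm fun K => ?_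
    obtain ⟨r, hr⟩ := K.isCompact.isBounded.exists_norm_le
    obtain ⟨M, hM⟩ := f.exists_bound (max r 0 + 2 * R)
    have hM0 : 0 ≤ M := (norm_nonneg _).trans (hM 0 (by simp; positivity))
    refine Summable.of_nonneg_of_le (fun _ => norm_nonneg _) (fun n => ?_)
      (summable_geometric_two.mul_left (A * M))
    refine (ContinuousMap.norm_le _ (by positivity)).2 fun z => ?_
    exact norm_term_le hA hR h f hM n ((hr z z.2).trans (le_max_left _ _))
  have hmem : (∑' n : ℕ, val (taylorCoeff Φ n • (D ^ n) f)) ∈ entireSubalgebra :=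
    isClosed.mem_of_tendsto hs.hasSum (Filter.Eventually.of_forall fun s =>
      entireSubalgebra.sum_mem fun n _ => (taylorCoeff Φ n • (D ^ n) f).differentiable)
  refine ⟨⟨_, hmem⟩, ?_⟩
  refine (Topology.IsInducing.hasSum_iff (g := val) isInducing_val _ _).1 ?_
  exact hs.hasSum

theorem norm_tsum_le {Φ : ℂ → ℂ} (hΦ : IsEntireOfExponentialType Φ) {A R : ℝ} (hA : 0 ≤ A)
    (hR : 0 < R) (h : ∀ n : ℕ, ‖taylorCoeff Φ n‖ ≤ A * R ^ n / n.factorial) (f : EntireFun)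
    {r M : ℝ} (hM : ∀ z : ℂ, ‖z‖ ≤ r + 2 * R → ‖f z‖ ≤ M) {z : ℂ} (hz : ‖z‖ ≤ r) :
    ‖(∑' n : ℕ, taylorCoeff Φ n • (D ^ n) f) z‖ ≤ A * M * 2 := by
  have h1 := ((summable_taylorCoeff_smul hΦ f).hasSum.map val isInducing_val.continuous)
  have h2 := ContinuousMap.hasSum_apply h1 z
  exact (h2.norm_le_of_bounded (hasSum_geometric_two.mul_left (A * M))
    fun n => norm_term_le hA hR h f hM n hz)

/-- The linear map `f ↦ ∑ aₙ Dⁿ f` on `H(ℂ)`, where `Φ(z) = ∑ aₙ zⁿ` is entire of exponential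
type; the series is summed in the compact-open topology. -/
noncomputable def series (Φ : ℂ → ℂ) (hΦ : IsEntireOfExponentialType Φ) :
    EntireFun →ₗ[ℂ] EntireFun where
  toFun f := ∑' n : ℕ, taylorCoeff Φ n • (D ^ n) f
  map_add' f g := by
    simp only [map_add, smul_add]
    exact (summable_taylorCoeff_smul hΦ f).tsum_add (summable_taylorCoeff_smul hΦ g)
  map_smul' c f := by
    simp only [map_smul, RingHom.id_apply, smul_comm _ c]
    exact (summable_taylorCoeff_smul hΦ f).tsum_const_smul c

theorem continuous_series {Φ : ℂ → ℂ} (hΦ : IsEntireOfExponentialType Φ) :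
    Continuous (series Φ hΦ) := by
  obtain ⟨A, R, hA, hR, h⟩ := hΦ.exists_coeff_bound
  refine isInducing_val.continuous_iff.2 (continuous_iff_continuousAt.2 fun f => ?_)
  refine ContinuousMap.tendsto_iff_forall_isCompact_tendstoUniformlyOn.2 fun K hK => ?_
  obtain ⟨r, hr⟩ := hK.isBounded.exists_norm_le
  refine Metric.tendstoUniformlyOn_iff.2 fun ε hε => ?_
  have hδ : 0 < ε / (A * 2 + 1) := by positivity
  have hid : Filter.Tendsto (val) (nhds f)
      (nhds (val f)) := isInducing_val.continuous.continuousAt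
  have hunif := ContinuousMap.tendsto_iff_forall_isCompact_tendstoUniformlyOn.1 hid _
    (isCompact_closedBall (0 : ℂ) (r + 2 * R))
  filter_upwards [Metric.tendstoUniformlyOn_iff.1 hunif _ hδ] with g hg z hz
  have key : ‖series Φ hΦ (f - g) z‖ ≤ A * (ε / (A * 2 + 1)) * 2 :=
    norm_tsum_le hΦ hA hR h (f - g) (r := r) (M := ε / (A * 2 + 1))
      (fun w hw => by
        have := hg w (by simpa using hw)
        rw [dist_eq_norm] at this
        exact this.le) (hr z hz)
  rw [(series Φ hΦ).map_sub f g] at key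
  change dist (series Φ hΦ f z)
    (series Φ hΦ g z) < ε
  rw [dist_eq_norm]
  refine lt_of_le_of_lt key ?_
  rw [show A * (ε / (A * 2 + 1)) * 2 = ε * (A * 2) / (A * 2 + 1) by ring,
    div_lt_iff₀ (by positivity)]
  nlinarith

end EntireFun

/-- The convolution operator `Φ(D) : H(ℂ) → H(ℂ)`, `f ↦ ∑ aₙ Dⁿ f`, where `Φ(z) = ∑ aₙ zⁿ` is
entire of exponential type, as a continuous linear operator. -/
noncomputable def convolutionOperator (Φ : ℂ → ℂ) (hΦ : IsEntireOfExponentialType Φ) :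
    EntireFun →L[ℂ] EntireFun where
  toLinearMap := EntireFun.series Φ hΦ
  cont := EntireFun.continuous_series hΦ

/-- `x` is a hypercyclic vector for `T` if its orbit `{Tⁿ x : n ≥ 0}` is dense. -/
def IsHypercyclicVector {X : Type*} [TopologicalSpace X] (T : X → X) (x : X) : Prop :=
  Dense (Set.range fun n : ℕ => T^[n] x)

/-- `T` supports a hypercyclic algebra: there is a nonzero (not necessarily unital) subalgebra all
of whose nonzero elements are hypercyclic vectors for `T`. -/
def SupportsHypercyclicAlgebra {X : Type*} [TopologicalSpace X] [Ring X] [Algebra ℂ X]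
    (T : X → X) : Prop :=
  ∃ A : NonUnitalSubalgebra ℂ X, A ≠ ⊥ ∧ ∀ x ∈ A, x ≠ 0 → IsHypercyclicVector T x

/-! ### Exponentials in the space of entire functions. -/

namespace EntireFun

open Filter Topology

/-! Every exponential `e^{αz}` is an eigenvector of `T = Φ(D)` with eigenvalue `Φ α`, and products
of exponentials are exponentials, so powers of exponential sums can be iterated explicitly. By a
Baire category argument (`supportsHypercyclicAlgebra_of_transitive`), it suffices to find, for each
`m`, some `f ∈ U` and `N` such that `T^N (f^m)` lies in `V` and the lower powers satisfy `T^N (f^j)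
≈ 0`. The leading term of a polynomial in `f` then dictates where the orbit goes.

The second-derivative hypothesis gives a direction `w` along which `g t = log ‖Φ (t w)‖` is strictly
convex and positive on `(0, δ]`, with `g 0 = 0`. Approximate a point of `U` by `∑ c_t e^{(a+tw)z}`
and a point of `V` by `∑ b_t e^{twz}`, with all `t` in `(0, δ)`. Let `f` be the first sum plus `∑
b_t^{1/m} ν_t^N e^{(t/m)wz}`, where `ν_t^m = 1/Φ (t w)`. Since `‖ν_t‖ < 1`, `f` tends to the first
sum as `N → ∞`.

Expand `T^N (f^j)` for `j ≤ m`. A product using `k ≥ 1` factors from the first sum has exponent near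
`k a`, where `‖Φ‖ < 1`, so it decays. A product of second-sum factors has modulus governed by `exp
(g (∑ t / m) - ∑ g t / m)`, which is less than one by strict convexity, unless `j = m` and all `t`
agree. Those exceptional products reproduce exactly `∑ b_t e^{twz}`. -/

instance : PolishSpace EntireFun :=
  haveI : PolishSpace C(ℂ, ℂ) := inferInstance
  IsClosed.polishSpace isClosed

theorem tendsto_nhds_iff {ι : Type*} {l : Filter ι} {u : ι → EntireFun} {f : EntireFun} :
    Tendsto u l (𝓝 f) ↔
      ∀ K : Set ℂ, IsCompact K → TendstoUniformlyOn (fun i z => u i z) f l K := by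
  rw [isInducing_val.tendsto_nhds_iff,
    ContinuousMap.tendsto_iff_forall_isCompact_tendstoUniformlyOn]
  rfl

/-- The coordinate function `z ↦ z`. -/
noncomputable def coord : EntireFun := mk (fun z => z) differentiable_id

/-- The exponential function `z ↦ e ^ (α z)`. -/
noncomputable def expFun (α : ℂ) : EntireFun := mk (fun z => Complex.exp (α * z)) (by fun_prop)

@[simp] theorem coord_apply (z : ℂ) : coord z = z := rfl

@[simp] theorem expFun_apply (α z : ℂ) : expFun α z = Complex.exp (α * z) := rfl

@[simp] theorem sub_apply (f g : EntireFun) (z : ℂ) : (f - g) z = f z - g z := rfl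

@[simp] theorem mul_apply (f g : EntireFun) (z : ℂ) : (f * g) z = f z * g z := rfl

@[simp] theorem one_apply (z : ℂ) : (1 : EntireFun) z = 1 := rfl

@[simp] theorem pow_apply (f : EntireFun) (n : ℕ) (z : ℂ) : (f ^ n) z = f z ^ n := rfl

@[simp] theorem smul_apply (c : ℂ) (f : EntireFun) (z : ℂ) : (c • f) z = c * f z := rfl

/-- Evaluation at a point as a linear map. -/
noncomputable def evalLin (z : ℂ) : EntireFun →ₗ[ℂ] ℂ where
  toFun f := f z
  map_add' _ _ := rfl
  map_smul' _ _ := rfl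

@[simp] theorem sum_apply {ι : Type*} (s : Finset ι) (f : ι → EntireFun) (z : ℂ) :
    (∑ i ∈ s, f i) z = ∑ i ∈ s, f i z := map_sum (evalLin z) f s

theorem expFun_add (α β : ℂ) : expFun (α + β) = expFun α * expFun β := by
  ext z
  simp [add_mul, Complex.exp_add]

theorem expFun_zero : expFun 0 = 1 := by
  ext z
  simp

theorem prod_expFun {ι : Type*} (s : Finset ι) (μ : ι → ℂ) :
    ∏ i ∈ s, expFun (μ i) = expFun (∑ i ∈ s, μ i) := by
  classical
  induction s using Finset.induction_on with
  | empty => simp [expFun_zero]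
  | insert i s hi ih => rw [Finset.prod_insert hi, Finset.sum_insert hi, ih, expFun_add]

/-- The derivative of `α ↦ e^{αz}` at zero in the compact-open topology, from `‖e^u - 1 - u‖ ≤ ‖u‖²`
uniformly for `z` in a compact set. -/
theorem tendsto_slope_expFun :
    Tendsto (fun h : ℂ => h⁻¹ • (expFun h - 1)) (𝓝[≠] 0) (𝓝 coord) := by
  refine tendsto_nhds_iff.2 fun K hK => Metric.tendstoUniformlyOn_iff.2 fun ε hε => ?_
  obtain ⟨r, hr0, hr⟩ := hK.isBounded.exists_pos_norm_le
  have hpos : 0 < min (1 / r) (ε / r ^ 2) := by positivity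
  filter_upwards [self_mem_nhdsWithin, mem_nhdsWithin_of_mem_nhds (Metric.ball_mem_nhds 0 hpos)]
    with h hne hh z hz
  rw [mem_ball_zero_iff, lt_min_iff, lt_div_iff₀ hr0, lt_div_iff₀ (by positivity)] at hh
  have hne' : h ≠ 0 := hne
  have hp : 0 < ‖h‖ := norm_pos_iff.2 hne'
  have hzr := hr z hz
  have h1 : ‖h * z‖ ≤ 1 := by
    rw [norm_mul]
    nlinarith [hh.1]
  have key := Complex.norm_exp_sub_one_sub_id_le h1
  rw [dist_comm, dist_eq_norm]
  have e : (h⁻¹ • (expFun h - 1)) z - coord z = h⁻¹ * (Complex.exp (h * z) - 1 - h * z) := by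
    simp
    field_simp
  rw [e, norm_mul, norm_inv, inv_mul_lt_iff₀ hp]
  refine key.trans_lt ?_
  rw [norm_mul]
  have h3 : ‖z‖ ^ 2 ≤ r ^ 2 := by gcongr
  nlinarith [hh.2, mul_le_mul_of_nonneg_left h3 hp.le]

/-- Differentiating in the exponent along `w` brings down a factor `z`. A closed subspace contains
limits of difference quotients, so induction produces all powers. -/
theorem coord_pow_mul_expFun_mem {S : Submodule ℂ EntireFun} (hS : IsClosed (S : Set EntireFun))
    {a w : ℂ} (hw : w ≠ 0) {s t : ℝ}
    (h : ∀ x ∈ Set.Ioo s t, expFun (a + x * w) ∈ S) (n : ℕ) :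
    ∀ x ∈ Set.Ioo s t, coord ^ n * expFun (a + x * w) ∈ S := by
  induction n with
  | zero => simpa using h
  | succ n ih =>
    intro x hx
    have h1 : Tendsto (fun y : ℝ => (y : ℂ) * w) (𝓝[≠] 0) (𝓝[≠] 0) := by
      refine tendsto_nhdsWithin_iff.2 ⟨?_, ?_⟩
      · have : Continuous fun y : ℝ => (y : ℂ) * w := by fun_prop
        simpa using (this.tendsto 0).mono_left nhdsWithin_le_nhds
      · filter_upwards [self_mem_nhdsWithin] with y hy
        exact mul_ne_zero (by exact_mod_cast hy) hw
    have h2 := (tendsto_slope_expFun.comp h1).const_mul (coord ^ n * expFun (a + x * w))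
    have e : coord ^ (n + 1) * expFun (a + x * w) = coord ^ n * expFun (a + x * w) * coord := by
      ring
    rw [e]
    refine hS.mem_of_tendsto h2 ?_
    have h3 : Tendsto (fun y : ℝ => x + y) (𝓝[≠] 0) (𝓝 x) := by
      have : Continuous fun y : ℝ => x + y := by fun_prop
      simpa using (this.tendsto 0).mono_left nhdsWithin_le_nhds
    filter_upwards [h3 (Ioo_mem_nhds hx.1 hx.2)] with y hy
    have e2 : coord ^ n * expFun (a + x * w) * (((y : ℂ) * w)⁻¹ • (expFun ((y : ℂ) * w) - 1))
        = ((y : ℂ) * w)⁻¹ • (coord ^ n * expFun (a + ((x + y : ℝ) : ℂ) * w)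
          - coord ^ n * expFun (a + x * w)) := by
      rw [mul_smul_comm, mul_sub, mul_one, mul_assoc, ← expFun_add]
      push_cast
      ring_nf
    exact e2 ▸ S.smul_mem _ (S.sub_mem (ih _ hy) (ih _ hx))

theorem exists_tendsto_sum_coord_pow (f : EntireFun) :
    ∃ c : ℕ → ℂ, Tendsto (fun n => ∑ k ∈ Finset.range n, c k • coord ^ k) atTop (𝓝 f) := by
  -- The Cauchy radius `1` is an arbitrary choice: for an entire function the series converges on
  -- the whole plane.
  have h := (f.differentiable.hasFPowerSeriesOnBall 0 (R := 1) one_pos)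
  refine ⟨fun k => (cauchyPowerSeries f 0 1).coeff k, tendsto_nhds_iff.2 fun K hK => ?_⟩
  have h2 := h.tendstoLocallyUniformlyOn
  simp only [Metric.eball_top] at h2
  have h3 := (tendstoLocallyUniformlyOn_iff_forall_isCompact isOpen_univ).1 h2 K
    (Set.subset_univ K) hK
  refine (h3.congr ?_).congr_right ?_
  · refine Eventually.of_forall fun n z _ => ?_
    simp [FormalMultilinearSeries.partialSum, mul_comm]
  · intro z _
    simp

/-- With one exponent `α = a + xw` fixed, the Taylor expansion of `f e^{-αz}`, multiplied back by
`e^{αz}`, writes `f` as a limit of combinations of `z^k e^{αz}`, all of which lie in the closed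
span. -/
theorem dense_span_expFun (a : ℂ) {w : ℂ} (hw : w ≠ 0) {s t : ℝ} (hst : s < t) :
    Dense (Submodule.span ℂ ((fun x : ℝ => expFun (a + x * w)) '' Set.Ioo s t) :
      Set EntireFun) := by
  set S := Submodule.span ℂ ((fun x : ℝ => expFun (a + x * w)) '' Set.Ioo s t)
  have hS : IsClosed (S.topologicalClosure : Set EntireFun) := S.isClosed_topologicalClosure
  obtain ⟨x, hx⟩ := exists_between hst
  have hmem := coord_pow_mul_expFun_mem hS hw (a := a) (s := s) (t := t) fun y hy =>
    S.le_topologicalClosure (Submodule.subset_span ⟨y, hy, rfl⟩)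
  intro f
  rw [← Submodule.topologicalClosure_coe]
  obtain ⟨c, hc⟩ := exists_tendsto_sum_coord_pow (f * expFun (-(a + x * w)))
  have h := hc.mul_const (expFun (a + x * w))
  rw [mul_assoc, ← expFun_add, neg_add_cancel, expFun_zero, mul_one] at h
  refine hS.mem_of_tendsto h (Eventually.of_forall fun n => ?_)
  rw [Finset.sum_mul]
  refine Submodule.sum_mem _ fun k _ => ?_
  rw [smul_mul_assoc]
  exact Submodule.smul_mem _ _ (hmem k x hx)

theorem exists_sum_expFun_mem (a : ℂ) {w : ℂ} (hw : w ≠ 0) {s t : ℝ} (hst : s < t)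
    {U : Set EntireFun} (hU : IsOpen U) (hne : U.Nonempty) :
    ∃ (σ : Finset ℝ) (c : ℝ → ℂ), (∀ x ∈ σ, x ∈ Set.Ioo s t) ∧
      ∑ x ∈ σ, c x • expFun (a + x * w) ∈ U := by
  obtain ⟨f, hfU, hf⟩ := (dense_span_expFun a hw hst).exists_mem_open hU hne |>.imp
    fun f h => And.comm.1 h
  obtain ⟨l, hl, rfl⟩ := (Finsupp.mem_span_image_iff_linearCombination ℂ).1 hf
  refine ⟨l.support, l, fun x hx => hl hx, ?_⟩
  simpa [Finsupp.linearCombination_apply, Finsupp.sum] using hfU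

theorem D_expFun (α : ℂ) : D (expFun α) = α • expFun α := by
  ext z
  change deriv (fun z => Complex.exp (α * z)) z = α * Complex.exp (α * z)
  rw [deriv_cexp (by fun_prop), deriv_const_mul_field, deriv_id'']
  ring

theorem D_pow_expFun (α : ℂ) (n : ℕ) : (D ^ n) (expFun α) = α ^ n • expFun α := by
  induction n with
  | zero => simp
  | succ n ih => rw [pow_succ', Module.End.mul_apply, ih, map_smul, D_expFun, smul_smul, pow_succ]

end EntireFun

/-! ### Exponentials as eigenvectors of the convolution operator. -/

open EntireFun

theorem convolutionOperator_expFun {Φ : ℂ → ℂ} (hΦ : IsEntireOfExponentialType Φ) (α : ℂ) :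
    convolutionOperator Φ hΦ (expFun α) = Φ α • expFun α := by
  have h := (Complex.hasSum_taylorSeries_of_entire hΦ.1 0 α).smul_const (expFun α)
  refine Eq.trans ?_ h.tsum_eq
  change ∑' n, _ = _
  refine tsum_congr fun n => ?_
  rw [D_pow_expFun, smul_smul, taylorCoeff, sub_zero, smul_eq_mul, smul_eq_mul]
  congr 1
  ring

theorem iterate_convolutionOperator_expFun {Φ : ℂ → ℂ} (hΦ : IsEntireOfExponentialType Φ) (α : ℂ)
    (n : ℕ) : (convolutionOperator Φ hΦ ^ n) (expFun α) = Φ α ^ n • expFun α := by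
  induction n with
  | zero => simp
  | succ n ih =>
    rw [pow_succ', mul_apply_eq_comp, ih, map_smul, convolutionOperator_expFun,
      smul_smul, pow_succ]

/-! ### From Baire category to a hypercyclic algebra. -/

open Filter Topology in
/-- A Birkhoff transitivity criterion for the existence of a singly generated hypercyclic
algebra. -/
theorem supportsHypercyclicAlgebra_of_transitive {X : Type*} [TopologicalSpace X] [CommRing X]
    [Algebra ℂ X] [IsTopologicalRing X] [ContinuousSMul ℂ X] [T1Space X] [Nontrivial X]
    [SecondCountableTopology X] [BaireSpace X] (T : X →L[ℂ] X)
    (h : ∀ m : ℕ, 1 ≤ m → ∀ U V W : Set X, IsOpen U → U.Nonempty → IsOpen V → V.Nonempty →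
      IsOpen W → (0 : X) ∈ W → ∃ f ∈ U, ∃ N : ℕ, (T ^ N) (f ^ m) ∈ V ∧
        ∀ j : ℕ, 1 ≤ j → j < m → (T ^ N) (f ^ j) ∈ W) :
    SupportsHypercyclicAlgebra T := by
  classical
  obtain ⟨B, hBc, hBe, hB⟩ := TopologicalSpace.exists_countable_basis X
  have : Countable B := hBc.to_subtype
  -- Countably many open conditions, with `V` and `W` restricted to a countable basis; indices that
  -- impose nothing get the whole space.
  let G : ℕ × B × B → Set X := fun i =>
    if 1 ≤ i.1 ∧ (0 : X) ∈ i.2.2.1 then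
      ⋃ N : ℕ, ({f | (T ^ N) (f ^ i.1) ∈ i.2.1.1} ∩
        ⋂ j ∈ Finset.Ico 1 i.1, {f | (T ^ N) (f ^ j) ∈ i.2.2.1})
    else Set.univ
  have hGo : ∀ i, IsOpen (G i) := by
    rintro ⟨m, V, W⟩
    simp only [G]
    split_ifs
    · refine isOpen_iUnion fun N => IsOpen.inter ?_ (isOpen_biInter_finset fun j _ => ?_)
      · exact (hB.isOpen V.2).preimage ((T ^ N).continuous.comp (continuous_pow m))
      · exact (hB.isOpen W.2).preimage ((T ^ N).continuous.comp (continuous_pow j))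
    · exact isOpen_univ
  have hGd : ∀ i, Dense (G i) := by
    rintro ⟨m, V, W⟩
    simp only [G]
    split_ifs with hc
    · refine dense_iff_inter_open.2 fun U hU hUne => ?_
      obtain ⟨f, hf, N, hN, hj⟩ := h m hc.1 U V W hU hUne (hB.isOpen V.2)
        (Set.nonempty_iff_ne_empty.2 fun he => hBe (he ▸ V.2)) (hB.isOpen W.2) hc.2
      refine ⟨f, hf, Set.mem_iUnion.2 ⟨N, hN, ?_⟩⟩
      simp only [Set.mem_iInter, Finset.mem_Ico]
      exact fun j hj' => hj j hj'.1 hj'.2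
    · exact dense_univ
  obtain ⟨f, hf⟩ := (dense_iInter_of_isOpen hGo hGd).nonempty
  have hfG : ∀ m : ℕ, 1 ≤ m → ∀ V W : Set X, IsOpen V → V.Nonempty → IsOpen W → (0 : X) ∈ W →
      ∃ N : ℕ, (T ^ N) (f ^ m) ∈ V ∧ ∀ j : ℕ, 1 ≤ j → j < m → (T ^ N) (f ^ j) ∈ W := by
    intro m hm V W hV ⟨y, hy⟩ hW h0
    obtain ⟨V', hV'B, -, hV'⟩ := hB.exists_subset_of_mem_open hy hV
    obtain ⟨W', hW'B, h0', hW'⟩ := hB.exists_subset_of_mem_open h0 hW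
    have := Set.mem_iInter.1 hf ⟨m, ⟨V', hV'B⟩, ⟨W', hW'B⟩⟩
    simp only [G, if_pos (show 1 ≤ m ∧ (0 : X) ∈ W' from ⟨hm, h0'⟩), Set.mem_iUnion] at this
    obtain ⟨N, hN, hj⟩ := this
    simp only [Set.mem_iInter, Finset.mem_Ico] at hj
    exact ⟨N, hV' hN, fun j h1 h2 => hW' (hj j ⟨h1, h2⟩)⟩
  let A : NonUnitalSubalgebra ℂ X :=
    { carrier := {x | ∃ P : Polynomial ℂ, P.coeff 0 = 0 ∧ Polynomial.aeval f P = x}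
      add_mem' := by
        rintro _ _ ⟨P, hP, rfl⟩ ⟨Q, hQ, rfl⟩
        exact ⟨P + Q, by simp [hP, hQ], map_add _ _ _⟩
      zero_mem' := ⟨0, by simp, map_zero _⟩
      mul_mem' := by
        rintro _ _ ⟨P, hP, rfl⟩ ⟨Q, hQ, rfl⟩
        exact ⟨P * Q, by simp [hP, Polynomial.mul_coeff_zero], map_mul _ _ _⟩
      smul_mem' := by
        rintro c _ ⟨P, hP, rfl⟩
        exact ⟨c • P, by simp [hP], map_smul _ _ _⟩ }
  refine ⟨A, fun hA => ?_, ?_⟩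
  -- If the algebra were zero then `f = 0`, so its orbit could not enter the complement of zero.
  · have hfA : f ∈ A := ⟨Polynomial.X, by simp, by simp⟩
    rw [hA, NonUnitalAlgebra.mem_bot] at hfA
    obtain ⟨N, hN, -⟩ := hfG 1 le_rfl {0}ᶜ Set.univ isOpen_compl_singleton
      ⟨1, by simp⟩ isOpen_univ trivial
    simp [hfA] at hN
  · rintro _ ⟨P, hP, rfl⟩ hx
    have hP0 : P ≠ 0 := by
      rintro rfl
      simp at hx
    have hdeg : 1 ≤ P.natDegree := by
      refine Nat.one_le_iff_ne_zero.2 fun hd => hP0 ?_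
      rw [Polynomial.eq_C_of_natDegree_eq_zero hd, hP, Polynomial.C_0]
    set m := P.natDegree
    have hexp : Polynomial.aeval f P
        = P.leadingCoeff • f ^ m + ∑ j ∈ Finset.Ico 1 m, P.coeff j • f ^ j := by
      rw [Polynomial.aeval_eq_sum_range, Finset.sum_range_succ, Finset.range_eq_Ico,
        Finset.sum_eq_sum_Ico_succ_bot hdeg, hP, zero_smul, zero_add, add_comm]
      rfl
    refine dense_iff_inter_open.2 fun V hV ⟨y, hy⟩ => ?_
    -- Continuity of the linear combination at leading part `y / lead` and remainder zero fixes how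
    -- close `T^N (f^m)` and the lower-order terms must be.
    let Ψ : X × X → X := fun q => P.leadingCoeff • q.1 + q.2
    have hΨ : Continuous Ψ := by fun_prop
    have hlead : P.leadingCoeff ≠ 0 := Polynomial.leadingCoeff_ne_zero.2 hP0
    have hΨy : Ψ (P.leadingCoeff⁻¹ • y, 0) ∈ V := by
      simpa [Ψ, smul_smul, hlead] using hy
    obtain ⟨V', W', hV', hW', hyV, h0W, hsub⟩ :=
      isOpen_prod_iff.1 (hV.preimage hΨ) _ _ hΨy
    let Θ : (ℕ → X) → X := fun q => ∑ j ∈ Finset.Ico 1 m, P.coeff j • q j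
    have hΘ : Continuous Θ := by fun_prop
    have hΘ0 : Θ 0 ∈ W' := by simpa [Θ] using h0W
    obtain ⟨I, u, hu, hIu⟩ := isOpen_pi_iff.1 (hW'.preimage hΘ) 0 hΘ0
    obtain ⟨N, hN, hj⟩ := hfG m hdeg V' (⋂ i ∈ I, u i) hV' ⟨_, hyV⟩
      (isOpen_biInter_finset fun i hi => (hu i hi).1)
      (Set.mem_iInter₂.2 fun i hi => (hu i hi).2)
    refine ⟨_, ?_, N, rfl⟩
    change (⇑T)^[N] _ ∈ V
    rw [← FunLike.coe_pow_eq_iterate T N, hexp, map_add, map_sum, map_smul]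
    simp only [map_smul]
    refine hsub (Set.mk_mem_prod hN ?_)
    -- Extended by zero, since the basic neighbourhood may also constrain coordinates outside `1, …,
    -- m - 1`.
    let q : ℕ → X := fun j => if j ∈ Finset.Ico 1 m then (T ^ N) (f ^ j) else 0
    have hq : q ∈ (I : Set ℕ).pi u := by
      intro i hi
      simp only [q]
      split_ifs with hi2
      · rw [Finset.mem_Ico] at hi2
        exact Set.mem_iInter₂.1 (hj i hi2.1 hi2.2) i hi
      · exact (hu i hi).2
    have hq2 : Θ q ∈ W' := hIu hq
    have e : Θ q = ∑ j ∈ Finset.Ico 1 m, P.coeff j • (T ^ N) (f ^ j) :=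
      Finset.sum_congr rfl fun j hj => by simp only [q, if_pos hj]
    rw [e] at hq2
    exact hq2

/-! ### Convexity of the logarithm of the modulus along a segment. -/

theorem HasDerivAt.log_norm {f : ℝ → ℂ} {f' : ℂ} {t : ℝ} (hf : HasDerivAt f f' t)
    (h0 : f t ≠ 0) : HasDerivAt (fun s => Real.log ‖f s‖) (f' / f t).re t := by
  -- Dividing by `f t` moves the base value to `1`, away from the branch cut of the logarithm.
  have h1 : HasDerivAt (fun s => Complex.log (f s / f t)) (f' / f t) t := by
    have := (hf.div_const (f t)).clog_real (by simp [h0])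
    simpa [h0] using this
  have h2 : HasDerivAt (fun s => (Complex.log (f s / f t)).re) (f' / f t).re t :=
    Complex.reCLM.hasFDerivAt.comp_hasDerivAt t h1
  refine (h2.add_const (Real.log ‖f t‖)).congr_of_eventuallyEq ?_
  filter_upwards [hf.continuousAt.eventually_ne h0] with s hs
  rw [Complex.log_re, norm_div, Real.log_div (norm_ne_zero_iff.2 hs) (norm_ne_zero_iff.2 h0)]
  ring

/-- A square root `w` of the conjugate of `q` makes `w² q = |q|²`; replacing `w` by `-w` preserves
this and fixes the sign of the linear term. -/
theorem exists_direction {p q : ℂ} (hq : q ≠ 0) :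
    ∃ w : ℂ, w ≠ 0 ∧ 0 ≤ (w * p).re ∧ 0 < (w ^ 2 * q).re := by
  obtain ⟨w, hw⟩ := IsAlgClosed.exists_pow_nat_eq (starRingEnd ℂ q) (n := 2) two_pos
  have hw0 : w ≠ 0 := by
    rintro rfl
    rw [zero_pow two_ne_zero, eq_comm, map_eq_zero] at hw
    exact hq hw
  have hpos : 0 < (w ^ 2 * q).re := by
    rw [hw, mul_comm, Complex.mul_conj, Complex.ofReal_re]
    exact Complex.normSq_pos.2 hq
  rcases le_total 0 (w * p).re with h | h
  · exact ⟨w, hw0, h, hpos⟩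
  · exact ⟨-w, neg_ne_zero.2 hw0, by simpa using h, by simpa using hpos⟩

open Filter Topology in
-- The second derivative of `log ‖Φ (t w)‖` is the real part of `w² (Φ'' Φ - Φ'²) / Φ²`. The
-- direction `w` makes it positive at zero, hence nearby, and makes the first derivative at zero
-- nonnegative, so the function also increases from the value zero.
theorem exists_strictConvexOn_log_norm {Φ : ℂ → ℂ} (hΦ : Differentiable ℂ Φ) (h0 : ‖Φ 0‖ = 1)
    (h2 : deriv (deriv Φ) 0 * Φ 0 ≠ deriv Φ 0 ^ 2) :
    ∃ w : ℂ, w ≠ 0 ∧ ∃ δ : ℝ, 0 < δ ∧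
      StrictConvexOn ℝ (Set.Icc 0 δ) (fun t : ℝ => Real.log ‖Φ (t * w)‖) ∧
      ∀ t ∈ Set.Ioc 0 δ, 1 < ‖Φ (t * w)‖ := by
  have hΦ0 : Φ 0 ≠ 0 := norm_ne_zero_iff.1 (by rw [h0]; exact one_ne_zero)
  set G : ℂ → ℂ := fun z => (deriv (deriv Φ) z * Φ z - deriv Φ z ^ 2) / Φ z ^ 2 with hG
  have hG0 : G 0 ≠ 0 := div_ne_zero (sub_ne_zero.2 h2) (pow_ne_zero _ hΦ0)
  obtain ⟨w, hw, hw1, hw2⟩ := exists_direction (p := deriv Φ 0 / Φ 0) hG0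
  have hcont : Continuous fun t : ℝ => (t : ℂ) * w := by fun_prop
  have hd1 := hΦ.deriv
  have hd2 := hd1.deriv
  have hGc : ContinuousAt G 0 :=
    ContinuousAt.div (((hd2.continuous.mul hΦ.continuous).sub (hd1.continuous.pow 2)).continuousAt)
      (hΦ.continuous.pow 2).continuousAt (pow_ne_zero _ hΦ0)
  have hev : ∀ᶠ t : ℝ in 𝓝 0, Φ (t * w) ≠ 0 ∧ 0 < (w ^ 2 * G (t * w)).re := by
    have hz : Tendsto (fun t : ℝ => (t : ℂ) * w) (𝓝 0) (𝓝 0) := by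
      simpa using hcont.tendsto 0
    have hre : ContinuousAt (fun z => (w ^ 2 * G z).re) 0 :=
      Complex.continuous_re.continuousAt.comp (continuousAt_const.mul hGc)
    exact hz.eventually ((hΦ.continuous.continuousAt.eventually_ne hΦ0).and
      (hre.eventually (lt_mem_nhds hw2)))
  obtain ⟨ε, hε, hball⟩ := Metric.eventually_nhds_iff.1 hev
  have hIcc : ∀ t ∈ Set.Icc 0 (ε / 2), Φ (t * w) ≠ 0 ∧ 0 < (w ^ 2 * G (t * w)).re := by
    intro t ht
    refine hball ?_
    rw [Real.dist_eq, sub_zero, abs_of_nonneg ht.1]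
    linarith [ht.2]
  have hline : ∀ t : ℝ, HasDerivAt (fun s : ℝ => (s : ℂ) * w) w t := fun t => by
    simpa using (Complex.ofRealCLM.hasDerivAt (x := t)).mul_const w
  set g : ℝ → ℝ := fun t => Real.log ‖Φ (t * w)‖
  set g₁ : ℝ → ℝ := fun t => (deriv Φ (t * w) * w / Φ (t * w)).re
  have hg : ∀ t ∈ Set.Icc 0 (ε / 2), HasDerivAt g (g₁ t) t := fun t ht =>
    HasDerivAt.log_norm ((hΦ (t * w)).hasDerivAt.comp t (hline t)) (hIcc t ht).1
  have hg₁ : ∀ t ∈ Set.Icc 0 (ε / 2), HasDerivAt g₁ (w ^ 2 * G (t * w)).re t := by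
    intro t ht
    have ha := ((hd1 (t * w)).hasDerivAt.comp t (hline t)).mul_const w
    have hb := ha.div ((hΦ (t * w)).hasDerivAt.comp t (hline t)) (hIcc t ht).1
    have hc := Complex.reCLM.hasFDerivAt.comp_hasDerivAt t hb
    refine hc.congr_deriv ?_
    simp only [Complex.reCLM_apply, Function.comp, hG]
    congr 1
    ring
  have hg₁mono : StrictMonoOn g₁ (Set.Icc 0 (ε / 2)) := by
    refine strictMonoOn_of_deriv_pos (convex_Icc _ _)
      (fun t ht => (hg₁ t ht).continuousAt.continuousWithinAt) fun t ht => ?_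
    have ht' := interior_subset ht
    rw [(hg₁ t ht').deriv]
    exact (hIcc t ht').2
  have hgc : ContinuousOn g (Set.Icc 0 (ε / 2)) := fun t ht =>
    (hg t ht).continuousAt.continuousWithinAt
  have hg₁0 : 0 ≤ g₁ 0 := by
    simp only [g₁, Complex.ofReal_zero, zero_mul]
    convert hw1 using 2
    ring
  have hmem0 : (0 : ℝ) ∈ Set.Icc 0 (ε / 2) := ⟨le_rfl, by positivity⟩
  refine ⟨w, hw, ε / 2, by positivity, ?_, ?_⟩
  · refine StrictMonoOn.strictConvexOn_of_deriv (convex_Icc _ _) hgc ?_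
    intro s hs t ht hst
    rw [(hg s (interior_subset hs)).deriv, (hg t (interior_subset ht)).deriv]
    exact hg₁mono (interior_subset hs) (interior_subset ht) hst
  · intro t ht
    have hgmono : StrictMonoOn g (Set.Icc 0 (ε / 2)) := by
      refine strictMonoOn_of_deriv_pos (convex_Icc _ _) hgc fun t ht => ?_
      rw [(hg t (interior_subset ht)).deriv]
      refine hg₁0.trans_lt (hg₁mono hmem0 (interior_subset ht) ?_)
      rw [interior_Icc] at ht
      exact ht.1
    have h3 := hgmono hmem0 ⟨ht.1.le, ht.2⟩ ht.1
    simp only [g, Complex.ofReal_zero, zero_mul, h0, Real.log_one] at h3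
    exact (Real.log_pos_iff (norm_nonneg _)).1 h3

/-- For `j = m` this is strict Jensen. For `j < m`, the argument is `j/m` times the mean of the `t
x` plus `1 - j/m` times zero; strictness comes from this mean being positive, so equal `t x` are
allowed. -/
theorem StrictConvexOn.map_sum_div_lt {g : ℝ → ℝ} {δ : ℝ}
    (hg : StrictConvexOn ℝ (Set.Icc 0 δ) g) (h0 : g 0 = 0) {j m : ℕ} (hj : 1 ≤ j) (hjm : j ≤ m)
    {t : Fin j → ℝ} (ht : ∀ x, t x ∈ Set.Ioc 0 δ) (hne : j = m → ∃ x y, t x ≠ t y) :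
    g ((∑ x, t x) / m) < (∑ x, g (t x)) / m := by
  have hj0 : (0 : ℝ) < j := by exact_mod_cast hj
  have hm0 : (0 : ℝ) < m := by exact_mod_cast hj.trans hjm
  have hmem : ∀ x ∈ Finset.univ, t x ∈ Set.Icc 0 δ := fun x _ => ⟨(ht x).1.le, (ht x).2⟩
  have hw : ∑ _x : Fin j, (1 / j : ℝ) = 1 := by
    simp [hj0.ne']
  have hsum : ∀ u : Fin j → ℝ, ∑ x, (1 / j : ℝ) • u x = (∑ x, u x) / j := fun u => by
    rw [← Finset.smul_sum, smul_eq_mul, one_div, inv_mul_eq_div]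
  rcases hjm.lt_or_eq with hlt | rfl
  · have h1 := hg.convexOn.map_sum_le (t := Finset.univ) (w := fun _ => (1 / j : ℝ)) (p := t)
      (fun _ _ => by positivity) hw hmem
    have hA := hg.1.sum_mem (t := Finset.univ) (w := fun _ => (1 / j : ℝ)) (z := t)
      (fun _ _ => by positivity) hw hmem
    rw [hsum] at h1 hA
    rw [hsum (fun x => g (t x))] at h1
    have : Nonempty (Fin j) := ⟨⟨0, hj⟩⟩
    have hpos : 0 < ∑ x, t x := Finset.sum_pos (fun x _ => (ht x).1) Finset.univ_nonempty
    have hδ : 0 ≤ δ := hA.1.trans hA.2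
    have hjm' : (j : ℝ) < m := by exact_mod_cast hlt
    have h2 := hg.2 hA ⟨le_rfl, hδ⟩ (by positivity)
      (show (0 : ℝ) < j / m by positivity)
      (show (0 : ℝ) < 1 - j / m by rw [sub_pos, div_lt_one hm0]; exact hjm') (by ring)
    simp only [smul_eq_mul, mul_zero, add_zero, h0] at h2
    rw [div_mul_div_comm, mul_comm (m : ℝ), mul_div_mul_left _ _ hj0.ne'] at h2
    refine h2.trans_le ((mul_le_mul_of_nonneg_left h1 (by positivity)).trans_eq ?_)
    field_simp
  · obtain ⟨x, y, hxy⟩ := hne rfl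
    have h1 := hg.map_sum_lt (t := Finset.univ) (w := fun _ => (1 / j : ℝ)) (p := t)
      (fun _ _ => by positivity) hw hmem ⟨x, Finset.mem_univ _, y, Finset.mem_univ _, hxy⟩
    rwa [hsum, hsum (fun x => g (t x))] at h1

/-! ### Expanding powers of exponential sums and estimating the terms. -/

open Filter Topology in
theorem tendsto_sum_mul_pow_smul {ι X : Type*} [AddCommGroup X] [Module ℂ X]
    [TopologicalSpace X] [ContinuousAdd X] [ContinuousSMul ℂ X] {P C : Finset ι} (hCP : C ⊆ P)
    (A q : ι → ℂ) (e : ι → X) (h1 : ∀ p ∈ C, q p = 1) (h2 : ∀ p ∈ P, p ∉ C → ‖q p‖ < 1) :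
    Tendsto (fun N : ℕ => ∑ p ∈ P, (A p * q p ^ N) • e p) atTop (𝓝 (∑ p ∈ C, A p • e p)) := by
  classical
  have : ∑ p ∈ C, A p • e p = ∑ p ∈ P, (A p * if p ∈ C then 1 else 0) • e p := by
    rw [← Finset.sum_subset hCP]
    · exact Finset.sum_congr rfl fun p hp => by simp [hp]
    · intro p _ hp
      simp [hp]
  rw [this]
  refine tendsto_finsetSum _ fun p hp => Tendsto.smul_const (Tendsto.const_mul _ ?_) _
  split_ifs with hpC
  · exact tendsto_const_nhds.congr fun N => by rw [h1 p hpC, one_pow]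
  · exact tendsto_pow_atTop_nhds_zero_of_norm_lt_one (h2 p hp hpC)

namespace EntireFun

theorem iterate_convolutionOperator_sum_pow {Φ : ℂ → ℂ} (hΦ : IsEntireOfExponentialType Φ)
    {ι : Type*} (S : Finset ι) (d ρ μ : ι → ℂ) (N j : ℕ) :
    (convolutionOperator Φ hΦ ^ N) ((∑ i ∈ S, (d i * ρ i ^ N) • expFun (μ i)) ^ j)
      = ∑ p ∈ Fintype.piFinset fun _ : Fin j => S, ((∏ x, d (p x)) *
          ((∏ x, ρ (p x)) * Φ (∑ x, μ (p x))) ^ N) • expFun (∑ x, μ (p x)) := by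
  classical
  rw [Finset.sum_pow', map_sum]
  refine Finset.sum_congr rfl fun p _ => ?_
  rw [Finset.prod_smul, prod_expFun, map_smul, iterate_convolutionOperator_expFun, smul_smul,
    Finset.prod_mul_distrib, Finset.prod_pow, mul_pow, mul_assoc]

/-- The exponents used in the construction: those near `a` on the left, those near the origin on
the right. -/
noncomputable def exponent (a w : ℂ) (m : ℕ) : ℝ ⊕ ℝ → ℂ :=
  Sum.elim (fun t => a + t * w) (fun t => ((t / m : ℝ) : ℂ) * w)

/-- If `k ≥ 1` of the factors are on the left, the exponents add up to `k a + z` with `1 ≤ k ≤ m`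
and `‖z‖ ≤ m δ ‖w‖ < r`. -/
theorem norm_apply_sum_exponent_lt_one {Φ : ℂ → ℂ} {a w : ℂ} {m : ℕ} {r δ : ℝ}
    (hr : ∀ k : ℕ, 1 ≤ k → k ≤ m → ∀ z : ℂ, ‖z‖ < r → ‖Φ (k * a + z)‖ < 1)
    (hδ : m * (δ * ‖w‖) < r) {j : ℕ} (hjm : j ≤ m) {p : Fin j → ℝ ⊕ ℝ}
    (hp : ∀ x, Sum.elim id id (p x) ∈ Set.Ioo 0 δ) (hx : ∃ x, (p x).isLeft) :
    ‖Φ (∑ x, exponent a w m (p x))‖ < 1 := by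
  classical
  obtain ⟨x₀, hx₀⟩ := hx
  let s : ℝ ⊕ ℝ → ℝ := Sum.elim id (fun t => t / m)
  have hm : (1 : ℝ) ≤ m := by exact_mod_cast (Nat.one_le_of_lt x₀.2).trans hjm
  have e : ∀ i, exponent a w m i = (if i.isLeft then a else 0) + s i * w := by
    rintro (t | t) <;> simp [exponent, s]
  simp only [e, Finset.sum_add_distrib]
  rw [← Finset.sum_filter, Finset.sum_const, nsmul_eq_mul]
  refine hr _ (Finset.card_pos.2 ⟨x₀, by simp [hx₀]⟩)
    ((Finset.card_le_univ _).trans (by simpa using hjm)) _ (lt_of_le_of_lt ?_ hδ)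
  have hs : ∀ x, ‖(s (p x) : ℂ) * w‖ ≤ δ * ‖w‖ := by
    intro x
    rw [norm_mul, Complex.norm_real, Real.norm_eq_abs]
    gcongr
    have := hp x
    rcases h : p x with t | t
    · rw [h] at this
      simp only [Sum.elim_inl, id, Set.mem_Ioo, s] at this ⊢
      rw [abs_of_pos this.1]
      exact this.2.le
    · rw [h] at this
      simp only [Sum.elim_inr, id, Set.mem_Ioo, s] at this ⊢
      rw [abs_of_pos (div_pos this.1 (by positivity))]
      exact (div_le_self this.1.le hm).trans this.2.le
  have hpos : 0 ≤ δ * ‖w‖ := (norm_nonneg _).trans (hs x₀)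
  refine (norm_sum_le _ _).trans ((Finset.sum_le_sum fun x _ => hs x).trans ?_)
  rw [Finset.sum_const, nsmul_eq_mul, Finset.card_univ, Fintype.card_fin]
  gcongr

theorem norm_eq_exp_of_pow_eq_inv {z ρ : ℂ} {m : ℕ} (hm : 1 ≤ m) (hz : z ≠ 0)
    (h : ρ ^ m = z⁻¹) : ‖ρ‖ = Real.exp (-(Real.log ‖z‖ / m)) := by
  have hm0 : (m : ℝ) ≠ 0 := by positivity
  refine (pow_left_inj₀ (norm_nonneg _) (Real.exp_pos _).le (Nat.one_le_iff_ne_zero.1 hm)).1 ?_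
  rw [← norm_pow, h, ← Real.exp_nat_mul, norm_inv, mul_neg, mul_div_cancel₀ _ hm0, Real.exp_neg,
    Real.exp_log (norm_pos_iff.2 hz)]

/-- Taking logarithms, the product of the `m`-th roots contributes `-∑ g (t x) / m` and the
eigenvalue contributes `g (∑ t x / m)`, so strict convexity makes the total negative. -/
theorem norm_prod_mul_apply_lt_one {Φ : ℂ → ℂ} {w : ℂ} {δ : ℝ}
    (hg : StrictConvexOn ℝ (Set.Icc 0 δ) fun t : ℝ => Real.log ‖Φ (t * w)‖) (h0 : ‖Φ 0‖ = 1)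
    (hgt : ∀ t ∈ Set.Ioc 0 δ, 1 < ‖Φ (t * w)‖) {j m : ℕ} (hj : 1 ≤ j) (hjm : j ≤ m)
    {ρ : ℝ → ℂ} {t : Fin j → ℝ} (ht : ∀ x, t x ∈ Set.Ioo 0 δ)
    (hρ : ∀ x, ρ (t x) ^ m = (Φ (t x * w))⁻¹) (hne : j = m → ∃ x y, t x ≠ t y) :
    ‖(∏ x, ρ (t x)) * Φ (∑ x, ((t x / m : ℝ) : ℂ) * w)‖ < 1 := by
  have ht' : ∀ x, t x ∈ Set.Ioc 0 δ := fun x => ⟨(ht x).1, (ht x).2.le⟩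
  have key := hg.map_sum_div_lt (by simp [h0]) hj hjm ht' hne
  have hsum : ∑ x, ((t x / m : ℝ) : ℂ) * w = (((∑ x, t x) / m : ℝ) : ℂ) * w := by
    rw [← Finset.sum_mul, Finset.sum_div]
    push_cast
    rfl
  have hρn : ∀ x, ‖ρ (t x)‖ = Real.exp (-(Real.log ‖Φ (t x * w)‖ / m)) := fun x =>
    norm_eq_exp_of_pow_eq_inv (hj.trans hjm)
      (norm_pos_iff.1 (zero_lt_one.trans (hgt _ (ht' x)))) (hρ x)
  rw [norm_mul, norm_prod, hsum, Finset.prod_congr rfl fun x _ => hρn x, ← Real.exp_sum,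
    Finset.sum_neg_distrib, ← Finset.sum_div]
  -- The inequality `x ≤ exp (log x)` also holds for `x = 0`, so nonvanishing of `Φ` at the summed
  -- exponent need not be checked.
  refine lt_of_le_of_lt (mul_le_mul_of_nonneg_left (Real.le_exp_log _) (Real.exp_pos _).le) ?_
  rw [← Real.exp_add, Real.exp_lt_one_iff]
  linarith

end EntireFun

/-! ### Construction of the transitive vector. -/

open Filter Topology in
theorem exists_radius_norm_lt_one {Φ : ℂ → ℂ} (hΦ : Continuous Φ) {a : ℂ} {m : ℕ}
    (ha : ∀ j : ℕ, 1 ≤ j → j ≤ m → ‖Φ (j * a)‖ < 1) :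
    ∃ r : ℝ, 0 < r ∧ ∀ k : ℕ, 1 ≤ k → k ≤ m → ∀ z : ℂ, ‖z‖ < r → ‖Φ (k * a + z)‖ < 1 := by
  have h : ∀ᶠ z in 𝓝 (0 : ℂ), ∀ k ∈ Finset.Icc 1 m, ‖Φ (k * a + z)‖ < 1 := by
    refine (Finset.eventually_all _).2 fun k hk => ?_
    rw [Finset.mem_Icc] at hk
    have hc : Continuous fun z : ℂ => ‖Φ (k * a + z)‖ := by fun_prop
    exact hc.continuousAt.eventually_lt_const (by simpa using ha k hk.1 hk.2)
  obtain ⟨r, hr, hball⟩ := Metric.eventually_nhds_iff.1 h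
  exact ⟨r, hr, fun k h1 h2 z hz => hball (by simpa using hz) k (Finset.mem_Icc.2 ⟨h1, h2⟩)⟩

open Filter Topology EntireFun in
theorem convolutionOperator_transitive {Φ : ℂ → ℂ} (hΦ : IsEntireOfExponentialType Φ)
    (h0 : ‖Φ 0‖ = 1) (h2 : deriv (deriv Φ) 0 * Φ 0 ≠ deriv Φ 0 ^ 2) {m : ℕ} (hm : 1 ≤ m) {a : ℂ}
    (ha : ∀ j : ℕ, 1 ≤ j → j ≤ m → ‖Φ (j * a)‖ < 1) {U V W : Set EntireFun}
    (hU : IsOpen U) (hUne : U.Nonempty) (hV : IsOpen V) (hVne : V.Nonempty) (hW : IsOpen W)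
    (hW0 : 0 ∈ W) :
    ∃ f ∈ U, ∃ N : ℕ, (convolutionOperator Φ hΦ ^ N) (f ^ m) ∈ V ∧
      ∀ j : ℕ, 1 ≤ j → j < m → (convolutionOperator Φ hΦ ^ N) (f ^ j) ∈ W := by
  classical
  have hm0 : m ≠ 0 := Nat.one_le_iff_ne_zero.1 hm
  have hmR : (0 : ℝ) < m := by exact_mod_cast hm
  obtain ⟨w, hw, δ₀, hδ₀, hconv₀, hgt₀⟩ := exists_strictConvexOn_log_norm hΦ.1 h0 h2
  obtain ⟨r, hr0, hr⟩ := exists_radius_norm_lt_one hΦ.1.continuous ha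
  have hwpos : 0 < ‖w‖ := norm_pos_iff.2 hw
  -- The bound `δ₀` keeps convexity; the bound `r / (m ‖w‖)` keeps sums of up to `m` perturbations
  -- within `r` of a multiple of `a`.
  obtain ⟨δ, hδ, hδlt⟩ := exists_between (show (0 : ℝ) < min δ₀ (r / (m * ‖w‖)) by positivity)
  have hδδ₀ : δ ≤ δ₀ := (hδlt.trans_le (min_le_left _ _)).le
  have hδr : m * (δ * ‖w‖) < r := by
    have := (lt_div_iff₀ (by positivity)).1 (hδlt.trans_le (min_le_right _ _))
    linarith
  have hconv := hconv₀.subset (Set.Icc_subset_Icc_right hδδ₀) (convex_Icc 0 δ)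
  have hgt : ∀ t ∈ Set.Ioc 0 δ, 1 < ‖Φ (t * w)‖ := fun t ht => hgt₀ t ⟨ht.1, ht.2.trans hδδ₀⟩
  obtain ⟨σ, c, hσ, hu⟩ := exists_sum_expFun_mem a hw hδ hU hUne
  obtain ⟨τ, b, hτ, hv⟩ := exists_sum_expFun_mem 0 hw hδ hV hVne
  choose root hroot using fun z : ℂ => IsAlgClosed.exists_pow_nat_eq z (Nat.pos_of_ne_zero hm0)
  -- The `m`-th power of `ν t` cancels the eigenvalue of `e^{twz}`, the `m`-th power of
  -- `e^{(t/m)wz}`.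
  let ν : ℝ → ℂ := fun t => root (Φ (t * w))⁻¹
  have hν : ∀ t, ν t ^ m = (Φ (t * w))⁻¹ := fun t => hroot _
  have hνlt : ∀ t ∈ Set.Ioo 0 δ, ‖ν t‖ < 1 := by
    intro t ht
    have h1 := hgt t ⟨ht.1, ht.2.le⟩
    rw [norm_eq_exp_of_pow_eq_inv hm (norm_pos_iff.1 (zero_lt_one.trans h1)) (hν t),
      Real.exp_lt_one_iff, neg_neg_iff_pos]
    exact div_pos (Real.log_pos h1) hmR
  let S : Finset (ℝ ⊕ ℝ) := σ.disjSum τ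
  let d : ℝ ⊕ ℝ → ℂ := Sum.elim c fun t => root (b t)
  let ρ : ℝ ⊕ ℝ → ℂ := Sum.elim (fun _ => 1) ν
  let μ := exponent a w m
  let F : ℕ → EntireFun := fun N => ∑ i ∈ S, (d i * ρ i ^ N) • expFun (μ i)
  have hS : ∀ i ∈ S, Sum.elim id id i ∈ Set.Ioo 0 δ := by
    rintro (t | t) ht
    · exact hσ t (Finset.inl_mem_disjSum.1 ht)
    · exact hτ t (Finset.inr_mem_disjSum.1 ht)
  have hρle : ∀ i ∈ S, ‖ρ i‖ ≤ 1 := by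
    rintro (t | t) ht
    · simp [ρ]
    · exact (hνlt t (hS _ ht)).le
  have hF : Tendsto F atTop (𝓝 (∑ t ∈ σ, c t • expFun (a + t * w))) := by
    have := tendsto_sum_mul_pow_smul (P := S) (C := σ.map Function.Embedding.inl)
      (by
        intro i hi
        obtain ⟨t, ht, rfl⟩ := Finset.mem_map.1 hi
        exact Finset.inl_mem_disjSum.2 ht)
      d ρ (fun i => expFun (μ i)) (by simp [ρ]) (by
        rintro (t | t) ht hn
        · simp [Finset.inl_mem_disjSum.1 ht] at hn
        · exact hνlt t (hS _ ht))
    rw [Finset.sum_map] at this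
    exact this
  -- All products decay except the pure `m`-th powers of a single right-hand exponential.
  have hsmall : ∀ j : ℕ, 1 ≤ j → j ≤ m → ∀ p : Fin j → ℝ ⊕ ℝ, (∀ x, p x ∈ S) →
      (j = m → ∀ t ∈ τ, p ≠ fun _ => Sum.inr t) →
      ‖(∏ x, ρ (p x)) * Φ (∑ x, μ (p x))‖ < 1 := by
    intro j hj hjm p hp hne
    by_cases hx : ∃ x, (p x).isLeft
    · rw [norm_mul, norm_prod]
      refine (mul_le_of_le_one_left (norm_nonneg _)
        (Finset.prod_le_one (fun _ _ => norm_nonneg _) fun x _ => hρle _ (hp x))).trans_lt ?_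
      exact norm_apply_sum_exponent_lt_one hr hδr hjm (fun x => hS _ (hp x)) hx
    · push Not at hx
      have hx' : ∀ x, ∃ t, p x = Sum.inr t := fun x =>
        Sum.isRight_iff.1 (by simpa using hx x)
      choose t ht using hx'
      obtain rfl : p = fun x => Sum.inr (t x) := funext ht
      have htI : ∀ x, t x ∈ Set.Ioo 0 δ := fun x => hS _ (hp x)
      change ‖(∏ x, ν (t x)) * Φ (∑ x, ((t x / m : ℝ) : ℂ) * w)‖ < 1
      refine norm_prod_mul_apply_lt_one (ρ := ν) (t := t) hconv h0 hgt hj hjm htI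
        (fun x => hν (t x)) fun hjm' => ?_
      by_contra! hcon
      refine hne hjm' (t ⟨0, hj⟩) (Finset.inr_mem_disjSum.1 (hp _)) (funext fun x => ?_)
      rw [hcon x ⟨0, hj⟩]
  have hlow : ∀ j ∈ Finset.Ico 1 m,
      ∀ᶠ N in atTop, (convolutionOperator Φ hΦ ^ N) (F N ^ j) ∈ W := by
    intro j hj
    rw [Finset.mem_Ico] at hj
    simp only [F, iterate_convolutionOperator_sum_pow]
    have := tendsto_sum_mul_pow_smul (P := Fintype.piFinset fun _ : Fin j => S)
      (Finset.empty_subset _) (fun p => ∏ x, d (p x))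
      (fun p => (∏ x, ρ (p x)) * Φ (∑ x, μ (p x))) (fun p => expFun (∑ x, μ (p x)))
      (by simp) (fun p hp _ => hsmall j hj.1 hj.2.le p (Fintype.mem_piFinset.1 hp)
        fun h => absurd h hj.2.ne)
    exact this.eventually (hW.mem_nhds (by simpa using hW0))
  have htop : ∀ᶠ N in atTop, (convolutionOperator Φ hΦ ^ N) (F N ^ m) ∈ V := by
    simp only [F, iterate_convolutionOperator_sum_pow]
    -- Constant selections index the surviving terms: their exponents add up to `t w`, their ratio
    -- is exactly `1`, and their coefficient is `(root (b t))^m = b t`.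
    let κ : ℝ → Fin m → ℝ ⊕ ℝ := fun t _ => Sum.inr t
    have hκ : Function.Injective κ := fun s t h => Sum.inr_injective (congrFun h ⟨0, hm⟩)
    have hsum : ∀ t : ℝ, ∑ x, μ (κ t x) = 0 + t * w := by
      intro t
      simp only [μ, κ, exponent, Sum.elim_inr, Finset.sum_const, Finset.card_univ,
        Fintype.card_fin, nsmul_eq_mul]
      push_cast
      field_simp
      ring
    have := tendsto_sum_mul_pow_smul (P := Fintype.piFinset fun _ : Fin m => S)
      (C := τ.map ⟨κ, hκ⟩)
      (by
        intro p hp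
        obtain ⟨t, ht, rfl⟩ := Finset.mem_map.1 hp
        exact Fintype.mem_piFinset.2 fun _ => Finset.inr_mem_disjSum.2 ht)
      (fun p => ∏ x, d (p x))
      (fun p => (∏ x, ρ (p x)) * Φ (∑ x, μ (p x))) (fun p => expFun (∑ x, μ (p x)))
      (by
        intro p hp
        obtain ⟨t, ht, rfl⟩ := Finset.mem_map.1 hp
        have hne : Φ (t * w) ≠ 0 :=
          norm_pos_iff.1 (zero_lt_one.trans (hgt t ⟨(hτ t ht).1, (hτ t ht).2.le⟩))
        simp only [Function.Embedding.coeFn_mk, hsum, zero_add]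
        simp [κ, ρ, hν, hne])
      (fun p hp hn => hsmall m hm le_rfl p (Fintype.mem_piFinset.1 hp) fun _ t ht h =>
        hn (Finset.mem_map.2 ⟨t, ht, h.symm⟩))
    refine this.eventually (hV.mem_nhds ?_)
    convert hv using 1
    rw [Finset.sum_map]
    refine Finset.sum_congr rfl fun t _ => ?_
    simp only [Function.Embedding.coeFn_mk, hsum]
    simp [κ, d, hroot]
  obtain ⟨N, h1, h3, h4⟩ := ((hF.eventually (hU.mem_nhds hu)).and
    (htop.and ((Finset.eventually_all _).2 hlow))).exists
  exact ⟨F N, h1, N, h3, fun j hj hjm => h4 j (Finset.mem_Ico.2 ⟨hj, hjm⟩)⟩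

theorem theorem1p3 (Φ : ℂ → ℂ) (hΦ : IsEntireOfExponentialType Φ)
    (h0 : ‖Φ 0‖ = 1)
    (h2 : deriv (deriv Φ) 0 * Φ 0 ≠ deriv Φ 0 ^ 2)
    (hprog : ∀ m : ℕ, ∃ a : ℂ, a ≠ 0 ∧
      ∀ j : ℕ, 1 ≤ j → j ≤ m → (j : ℂ) * a ∈ Φ ⁻¹' Metric.ball (0 : ℂ) 1) :
    SupportsHypercyclicAlgebra (convolutionOperator Φ hΦ) := by
  have : Nontrivial EntireFun := ⟨0, 1, fun h => zero_ne_one (congrArg (fun f => f 0) h)⟩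
  refine supportsHypercyclicAlgebra_of_transitive _
    fun m hm U V W hU hUne hV hVne hW hW0 => ?_
  obtain ⟨a, -, ha⟩ := hprog m
  exact convolutionOperator_transitive hΦ h0 h2 hm
    (fun j h1 h2 => by simpa using ha j h1 h2) hU hUne hV hVne hW hW0
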